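/- Let $\phi_1(\mathbf x)=\tfrac12\mathbf x+(1,\tfrac32)$ and $\phi_2(\mathbf x)=\tfrac12\mathbf x+(-\tfrac12,\tfrac32)$ on $\mathbb R^2$, and $\Phi(A)=\phi_1(A)\cup\phi_2(A)$ for $A\subseteq\mathbb R^2$. Let $\Omega(\mathscr T_0)=[0,1]\times[0,1]\,\cup\,[-\tfrac12,\tfrac32]\times[1,\tfrac32]$, and let $\Omega(\mathscr T_n)=\bigcup_{j=0}^n\Phi^j(\Omega(\mathscr T_0))$ be the $n$-th prefractal $T$-table, a closed polygonal region with boundary $\mathscr T_n=\partial\Omega(\mathscr T_n)$. An initial condition of $\Omega(\mathscr T_n)$ is a pair $(x,\theta)$ of a point $x\in\mathscr T_n$ and a direction $\theta$ (a unit vector, identified with its angle) pointing from $x$ into the interior of the table. Its (forward) orbit consists of its iterates under the billiard map, which moves the basepoint along the direction through the interior of the table to the next boundary point and reflects the direction through the side containing that point; the orbit terminates if that point is a corner. The orbit is nonsingular if all iterates are defined and no basepoint is a corner of $\Omega(\mathscr T_n)$; it is periodic if its sequence of (basepoint, direction) pairs is periodic. For $m<n$, initial conditions $(x_m^0,\theta_m^0)$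 of $\Omega(\mathscr T_m)$ and $(x_n^0,\theta_n^0)$ of $\Omega(\mathscr T_n)$ are compatible if $\theta_m^0=\theta_n^0$ and $x_m^0,x_n^0$ both lie on a nondegenerate segment in that direction which meets $\mathscr T_n$ only at $x_n^0$. A sequence $\{(x_n^0,\theta_n^0)\}_{n\ge 0}$ of initial conditions of the tables $\Omega(\mathscr T_n)$ is compatible if any two of its terms are, and the corresponding orbits then form a sequence of compatible orbits. **Theorem.** Let $x_0^0=\frac{t}{h^k}$, where $t,k$ are positive integers, $h$ is a positive odd integer, $\gcd(t,h)=1$ and $0<t<h^k$. Let $\theta^0\in(0,\pi)$, $\theta^0\ne\frac{\pi}{2}$, and put $m=\tan\theta^0$. Suppose that at least one of the following holds: 1. $m\neq\dfrac{q\,2^{r-s}h^k}{p\,h^k-t\,2^r}$ for all $p,q,r,s\in\mathbb Z$ with $r,s\ge 0$; 2. $m=\dfrac{2^\gamma}{(2\alpha+1)^\beta}$ for some nonnegative integers $\alpha,\beta,\gamma$. Then there is a sequence of compatible initial conditions whose term at $n=0$ is $((x_0^0,0),\theta^0)$, and for every such sequence $\{(x_n^0,\theta^0)\}_{n\ge0}$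 and every $n\ge 0$ the orbit of $(x_n^0,\theta^0)$ in $\Omega(\mathscr T_n)$ is nonsingular. If moreover $m$ is rational, then each of these orbits is periodic. -/

import Mathlib

open Set Topology

noncomputable section

/-! ### The prefractal `T`-tables -/

/-- The first contraction of the iterated function system. -/
def tMapRight (x : ℝ × ℝ) : ℝ × ℝ := (1 / 2 : ℝ) • x + (1, 3 / 2)

/-- The second contraction of the iterated function system. -/
def tMapLeft (x : ℝ × ℝ) : ℝ × ℝ := (1 / 2 : ℝ) • x + (-1 / 2, 3 / 2)

/-- The action of the iterated function system on subsets of the plane. Its `j`-th iterate sends `A`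
to the union of the images of `A` under all compositions of `j` of the two contractions. -/
def tIFS (A : Set (ℝ × ℝ)) : Set (ℝ × ℝ) := tMapRight '' A ∪ tMapLeft '' A

/-- The base table: a `1 × 1` square with a `2 × 1/2` rectangle centred on top of it. -/
def tTableZero : Set (ℝ × ℝ) :=
  Icc (0 : ℝ) 1 ×ˢ Icc (0 : ℝ) 1 ∪ Icc (-1 / 2 : ℝ) (3 / 2) ×ˢ Icc (1 : ℝ) (3 / 2)

/-- The `n`-th prefractal `T`-table (a closed polygonal region). -/
def tTable (n : ℕ) : Set (ℝ × ℝ) := ⋃ j ≤ n, tIFS^[j] tTableZero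

/-! ### Billiards in a closed polygonal region `Ω`

The boundary of the table is `frontier Ω`. A direction is a unit vector, and a phase point is a
pair `(x, u)` of a basepoint `x` and a direction `u`. -/

/-- The point `x` lies in the relative interior of a side of `Ω` with unit direction vector `e`:
near `x`, the boundary of `Ω` is the line through `x` in direction `e`. -/
def IsSideDirection (Ω : Set (ℝ × ℝ)) (x e : ℝ × ℝ) : Prop :=
  e.1 ^ 2 + e.2 ^ 2 = 1 ∧
    ∃ U ∈ 𝓝 x, ∀ y ∈ U, y ∈ frontier Ω ↔ ∃ t : ℝ, y = x + t • e

/-- A corner (vertex): a boundary point that is not in the relative interior of a side. -/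
def IsTableCorner (Ω : Set (ℝ × ℝ)) (x : ℝ × ℝ) : Prop :=
  x ∈ frontier Ω ∧ ∀ e, ¬ IsSideDirection Ω x e

/-- Reflection of the vector `u` through the line spanned by the unit vector `e`. -/
def reflectDirection (e u : ℝ × ℝ) : ℝ × ℝ :=
  (2 * (u.1 * e.1 + u.2 * e.2)) • e - u

/-- `(x, u)` is an initial condition in `Ω`: `x` is a boundary point, and `u` is a direction
pointing from `x` into the interior of `Ω`. -/
def IsInitialCondition (Ω : Set (ℝ × ℝ)) (p : (ℝ × ℝ) × (ℝ × ℝ)) : Prop :=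
  p.1 ∈ frontier Ω ∧ p.2.1 ^ 2 + p.2.2 ^ 2 = 1 ∧
    ∃ ε > 0, ∀ s ∈ Ioo (0 : ℝ) ε, p.1 + s • p.2 ∈ interior Ω

/-- A point mass starting at the basepoint of `p` in the direction of `p` moves through the interior
of `Ω` until it meets the boundary again, for the first time, at `y`. -/
def FirstCollision (Ω : Set (ℝ × ℝ)) (p : (ℝ × ℝ) × (ℝ × ℝ)) (y : ℝ × ℝ) : Prop :=
  ∃ s > (0 : ℝ), (∀ r ∈ Ioo (0 : ℝ) s, p.1 + r • p.2 ∈ interior Ω) ∧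
    y = p.1 + s • p.2 ∧ y ∈ frontier Ω

/-- The graph of the billiard map of `Ω`: `q` is the collision point following `p`, together with
the incoming direction reflected through the side that contains this point. The map is not defined
at `p` when the collision happens at a corner. -/
def BilliardStep (Ω : Set (ℝ × ℝ)) (p q : (ℝ × ℝ) × (ℝ × ℝ)) : Prop :=
  FirstCollision Ω p q.1 ∧ ∃ e, IsSideDirection Ω q.1 e ∧ q.2 = reflectDirection e p.2

/-- `o` is the infinite forward orbit of the initial condition `p`, so `o k` is the `k`-th iterate
of `p` under the billiard map. -/
def IsBilliardOrbit (Ω : Set (ℝ × ℝ)) (p : (ℝ × ℝ) × (ℝ × ℝ))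
    (o : ℕ → (ℝ × ℝ) × (ℝ × ℝ)) : Prop :=
  o 0 = p ∧ ∀ k, BilliardStep Ω (o k) (o (k + 1))

/-- The (forward) orbit of `p` is nonsingular: all iterates of `p` under the billiard map are
defined, and none of their basepoints is a corner. -/
def HasNonsingularOrbit (Ω : Set (ℝ × ℝ)) (p : (ℝ × ℝ) × (ℝ × ℝ)) : Prop :=
  ∃ o, IsBilliardOrbit Ω p o ∧ ∀ k, ¬ IsTableCorner Ω (o k).1

/-- The orbit of `p` is periodic: it returns to the same basepoints with the same directions after
a fixed positive number of collisions. -/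
def HasPeriodicOrbit (Ω : Set (ℝ × ℝ)) (p : (ℝ × ℝ) × (ℝ × ℝ)) : Prop :=
  ∃ o, IsBilliardOrbit Ω p o ∧ ∃ N > 0, ∀ k, o (k + N) = o k

/-! ### Compatible initial conditions -/

/-- Compatibility of an initial condition `p` of the `m`-th table and an initial condition `q` of the
`n`-th table, for `m < n`: the directions agree, and both basepoints lie on a (nondegenerate) segment
in that direction which meets the boundary of the `n`-th table only at the basepoint of `q`. -/
def AreCompatible (m n : ℕ) (p q : (ℝ × ℝ) × (ℝ × ℝ)) : Prop :=
  IsInitialCondition (tTable m) p ∧ IsInitialCondition (tTable n) q ∧ p.2 = q.2 ∧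
    ∃ a b : ℝ, a < b ∧
      p.1 ∈ (fun s : ℝ => q.1 + s • q.2) '' Icc a b ∧
      ((fun s : ℝ => q.1 + s • q.2) '' Icc a b) ∩ frontier (tTable n) = {q.1}

/-- A sequence of compatible initial conditions: its `n`-th term is an initial condition of the
`n`-th table, and any two terms are compatible. The corresponding orbits form a sequence of compatible
orbits. -/
def IsCompatibleSequence (c : ℕ → (ℝ × ℝ) × (ℝ × ℝ)) : Prop :=
  ∀ m n, m < n → AreCompatible m n (c m) (c n)

end

/-! The table `tTable n` is a union of closed cells of the square grid of mesh `2^-(n+1)`, so all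
its sides lie on grid lines and all its corners are grid points. Reflections in grid lines preserve
the grid. Hence an orbit folds up a single straight line, the one through `(x₀, 0)` of slope `m`,
and can reach a corner only if that line contains a point with both coordinates in `2^-(n+1) ℤ`.
Both slope conditions exclude this (`slope_avoids_grid`), essentially because `h > 1` is odd and
prime to `t`; `IsFoldedState.exists_step` then continues the orbit forever.

If `m` is rational, the line crosses the grid lines only in points of a finer grid
(`exists_finer_grid`). So finitely many phase points unfold to the line, the billiard map is
injective on them (`eq_of_common_step`), and every orbit is periodic.

Compatibility adds nothing to the dynamics: `(x₀, 0)` is a boundary point of every table, so a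
compatible sequence starting there is constant (`IsCompatibleSequence.eq_base`), and each table can
be treated separately. -/

/-! ### Regions made of cells of a square grid -/

/-- The closed cell with index `c` of the square grid of mesh `δ`. -/
def gridCell (δ : ℝ) (c : ℤ × ℤ) : Set (ℝ × ℝ) :=
  Icc (c.1 * δ) ((c.1 + 1) * δ) ×ˢ Icc (c.2 * δ) ((c.2 + 1) * δ)

/-- A union of closed cells of the square grid of mesh `δ`. -/
def IsGridRegion (δ : ℝ) (T : Set (ℝ × ℝ)) : Prop :=
  ∃ S : Set (ℤ × ℤ), T = ⋃ c ∈ S, gridCell δ c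

theorem exists_grid_interval {δ v : ℝ} (hδ : 0 < δ) (hv : v ∉ AddSubgroup.zmultiples δ) :
    ∃ j : ℤ, v ∈ Ioo (j * δ) ((j + 1) * δ) := by
  refine ⟨⌊v / δ⌋, lt_of_le_of_ne ?_ ?_, ?_⟩
  · exact (le_div_iff₀ hδ).1 (Int.floor_le _)
  · intro h
    exact hv (AddSubgroup.mem_zmultiples_iff.2 ⟨_, by rw [zsmul_eq_mul, h]⟩)
  · exact (div_lt_iff₀ hδ).1 (Int.lt_floor_add_one _)

theorem grid_index_lt {δ : ℝ} (hδ : 0 < δ) {i j : ℤ} (h : (i : ℝ) * δ < (j + 1) * δ) : i ≤ j := by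
  have := lt_of_mul_lt_mul_right h hδ.le
  exact Int.lt_add_one_iff.1 (by exact_mod_cast this)

theorem IsGridRegion.preimage_swap {δ : ℝ} {T : Set (ℝ × ℝ)} (h : IsGridRegion δ T) :
    IsGridRegion δ (Prod.swap ⁻¹' T) := by
  obtain ⟨S, rfl⟩ := h
  refine ⟨Prod.swap ⁻¹' S, ?_⟩
  ext z
  simp only [gridCell, mem_preimage, mem_iUnion, mem_prod, exists_prop, Prod.exists, Prod.fst_swap,
    Prod.snd_swap, Prod.swap_prod_mk]
  constructor
  · rintro ⟨a, b, h, h1, h2⟩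
    exact ⟨b, a, h, h2, h1⟩
  · rintro ⟨a, b, h, h1, h2⟩
    exact ⟨b, a, h, h2, h1⟩

/-- A boundary point of a grid region lies on a line of the grid. -/
theorem IsGridRegion.mem_zmultiples_of_mem_frontier {δ : ℝ} (hδ : 0 < δ) {T : Set (ℝ × ℝ)}
    (h : IsGridRegion δ T) {y : ℝ × ℝ} (hy : y ∈ frontier T) :
    y.1 ∈ AddSubgroup.zmultiples δ ∨ y.2 ∈ AddSubgroup.zmultiples δ := by
  by_contra! hc
  obtain ⟨i, hi⟩ := exists_grid_interval hδ hc.1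
  obtain ⟨j, hj⟩ := exists_grid_interval hδ hc.2
  obtain ⟨S, rfl⟩ := h
  have hU : Ioo (i * δ) ((i + 1) * δ) ×ˢ Ioo (j * δ) ((j + 1) * δ) ∈ 𝓝 y :=
    prod_mem_nhds (isOpen_Ioo.mem_nhds hi) (isOpen_Ioo.mem_nhds hj)
  -- A closed cell meeting an open cell is its closure, so the region either contains the open cell
  -- around `y` or misses it.
  by_cases hS : (i, j) ∈ S
  · refine hy.2 (mem_interior_iff_mem_nhds.2 (Filter.mem_of_superset hU fun z hz => ?_))
    exact mem_biUnion hS ⟨Ioo_subset_Icc_self hz.1, Ioo_subset_Icc_self hz.2⟩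
  · obtain ⟨z, hz, hzT⟩ := mem_closure_iff_nhds.1 hy.1 _ hU
    simp only [gridCell, mem_iUnion, exists_prop, mem_prod, mem_Icc, mem_Ioo] at hz hzT
    obtain ⟨⟨a, b⟩, hab, h1, h2⟩ := hzT
    have e1 : a = i := le_antisymm (grid_index_lt hδ (h1.1.trans_lt hz.1.2))
      (grid_index_lt hδ (hz.1.1.trans_le h1.2))
    have e2 : b = j := le_antisymm (grid_index_lt hδ (h2.1.trans_lt hz.2.2))
      (grid_index_lt hδ (hz.2.1.trans_le h2.2))
    exact hS (e1 ▸ e2 ▸ hab)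

/-- Near a point inside a vertical edge of the grid, a grid region is a vertical half-plane, the
whole plane or empty. -/
theorem IsGridRegion.inter_eq_preimage_fst {δ : ℝ} (hδ : 0 < δ) {T : Set (ℝ × ℝ)}
    (h : IsGridRegion δ T) {y : ℝ × ℝ} (h1 : y.1 ∈ AddSubgroup.zmultiples δ)
    (h2 : y.2 ∉ AddSubgroup.zmultiples δ) :
    ∃ U : Set (ℝ × ℝ), IsOpen U ∧ y ∈ U ∧ ∃ I : Set ℝ,
      (I = ∅ ∨ I = Iic y.1 ∨ I = Ici y.1 ∨ I = univ) ∧ T ∩ U = Prod.fst ⁻¹' I ∩ U := by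
  obtain ⟨i, hi⟩ := AddSubgroup.mem_zmultiples_iff.1 h1
  rw [zsmul_eq_mul] at hi
  obtain ⟨j, hj⟩ := exists_grid_interval hδ h2
  obtain ⟨S, rfl⟩ := h
  refine ⟨Ioo ((i - 1) * δ) ((i + 1) * δ) ×ˢ Ioo (j * δ) ((j + 1) * δ), isOpen_Ioo.prod isOpen_Ioo,
    ⟨⟨by rw [← hi]; linarith, by rw [← hi]; linarith⟩, hj⟩, ?_⟩
  have key : ∀ z ∈ Ioo ((i - 1) * δ) ((i + 1) * δ) ×ˢ Ioo (j * δ) ((j + 1) * δ),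
      z ∈ (⋃ c ∈ S, gridCell δ c) ↔
        ((i - 1, j) ∈ S ∧ z.1 ≤ y.1) ∨ ((i, j) ∈ S ∧ y.1 ≤ z.1) := by
    intro z hz
    simp only [gridCell, mem_iUnion, exists_prop, mem_prod, mem_Icc, mem_Ioo] at hz ⊢
    constructor
    · rintro ⟨⟨a, b⟩, hab, ha, hb⟩
      have e2 : b = j := le_antisymm (grid_index_lt hδ (hb.1.trans_lt hz.2.2))
        (grid_index_lt hδ (hz.2.1.trans_le hb.2))
      have a1 : a ≤ i := grid_index_lt hδ (ha.1.trans_lt hz.1.2)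
      have a2 : i - 1 ≤ a := grid_index_lt hδ (by push_cast; exact hz.1.1.trans_le ha.2)
      subst e2
      rcases (show a = i - 1 ∨ a = i by omega) with rfl | rfl
      · refine Or.inl ⟨hab, ?_⟩
        have := ha.2
        push_cast at this
        rw [← hi]; linarith
      · exact Or.inr ⟨hab, by rw [← hi]; exact ha.1⟩
    · rintro (⟨hab, hz1⟩ | ⟨hab, hz1⟩)
      · refine ⟨_, hab, ⟨?_, ?_⟩, hz.2.1.le, hz.2.2.le⟩
        · push_cast; exact hz.1.1.le
        · push_cast; rw [← hi] at hz1; linarith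
      · exact ⟨_, hab, ⟨by rw [← hi] at hz1; exact hz1, hz.1.2.le⟩, hz.2.1.le, hz.2.2.le⟩
  refine ⟨{v | ((i - 1, j) ∈ S ∧ v ≤ y.1) ∨ ((i, j) ∈ S ∧ y.1 ≤ v)}, ?_, ?_⟩
  · by_cases s1 : (i - 1, j) ∈ S <;> by_cases s2 : (i, j) ∈ S
    · exact Or.inr (Or.inr (Or.inr (by ext v; simpa [s1, s2] using le_total v y.1)))
    · exact Or.inr (Or.inl (by ext v; simp [s1, s2]))
    · exact Or.inr (Or.inr (Or.inl (by ext v; simp [s1, s2])))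
    · exact Or.inl (by ext v; simp [s1, s2])
  · ext z
    simp only [mem_inter_iff]
    exact and_congr_left (key z)

/-- Near a boundary point inside a vertical edge of the grid, the boundary of a grid region is a
vertical line, and its interior is invariant under vertical shifts. -/
theorem IsGridRegion.frontier_near_vertical_edge {δ : ℝ} (hδ : 0 < δ) {T : Set (ℝ × ℝ)}
    (h : IsGridRegion δ T) {y : ℝ × ℝ} (hy : y ∈ frontier T)
    (h1 : y.1 ∈ AddSubgroup.zmultiples δ) (h2 : y.2 ∉ AddSubgroup.zmultiples δ) :
    ∃ U ∈ 𝓝 y, (∀ z ∈ U, z ∈ frontier T ↔ z.1 = y.1) ∧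
      ∀ z ∈ U, ∀ z' ∈ U, z.1 = z'.1 → z ∈ interior T → z' ∈ interior T := by
  obtain ⟨U, hU, hyU, I, hI, hTI⟩ := h.inter_eq_preimage_fst hδ h1 h2
  -- Interior and frontier are local on the open set `U` and pull back along the open map
  -- `Prod.fst`, which reduces everything to the subset `I` of the line.
  have hint : ∀ z ∈ U, z ∈ interior T ↔ z.1 ∈ interior I := by
    intro z hz
    have e : interior T ∩ U = interior (Prod.fst ⁻¹' I) ∩ U := by
      have := congrArg interior hTI
      rwa [interior_inter, interior_inter, hU.interior_eq] at this
    rw [← isOpenMap_fst.preimage_interior_eq_interior_preimage continuous_fst] at e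
    have := Set.ext_iff.1 e z
    simpa [hz] using this
  have hfr : ∀ z ∈ U, z ∈ frontier T ↔ z.1 ∈ frontier I := by
    intro z hz
    have e : frontier T ∩ U = frontier (Prod.fst ⁻¹' I) ∩ U := by
      rw [← frontier_inter_open_inter hU, hTI, frontier_inter_open_inter hU]
    rw [← isOpenMap_fst.preimage_frontier_eq_frontier_preimage continuous_fst] at e
    have := Set.ext_iff.1 e z
    simpa [hz] using this
  have hfI : frontier I = {y.1} := by
    have := (hfr y hyU).1 hy
    rcases hI with rfl | rfl | rfl | rfl
    · simp at this
    · exact frontier_Iic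
    · exact frontier_Ici
    · simp at this
  refine ⟨U, hU.mem_nhds hyU, fun z hz => ?_, fun z hz z' hz' hzz hzi => ?_⟩
  · rw [hfr z hz, hfI, mem_singleton_iff]
  · rw [hint z' hz', ← hzz]
    exact (hint z hz).1 hzi

/-- Near a boundary point inside a horizontal edge of the grid, the boundary of a grid region is a
horizontal line, and its interior is invariant under horizontal shifts. -/
theorem IsGridRegion.frontier_near_horizontal_edge {δ : ℝ} (hδ : 0 < δ) {T : Set (ℝ × ℝ)}
    (h : IsGridRegion δ T) {y : ℝ × ℝ} (hy : y ∈ frontier T)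
    (h1 : y.1 ∉ AddSubgroup.zmultiples δ) (h2 : y.2 ∈ AddSubgroup.zmultiples δ) :
    ∃ U ∈ 𝓝 y, (∀ z ∈ U, z ∈ frontier T ↔ z.2 = y.2) ∧
      ∀ z ∈ U, ∀ z' ∈ U, z.2 = z'.2 → z ∈ interior T → z' ∈ interior T := by
  have hf : Prod.swap ⁻¹' frontier T = frontier (Prod.swap ⁻¹' T) :=
    (Homeomorph.prodComm ℝ ℝ).preimage_frontier T
  have hi : Prod.swap ⁻¹' interior T = interior (Prod.swap ⁻¹' T) :=
    (Homeomorph.prodComm ℝ ℝ).preimage_interior T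
  have hy' : y.swap ∈ frontier (Prod.swap ⁻¹' T) := by rw [← hf]; simpa using hy
  obtain ⟨U, hU, hA, hB⟩ := h.preimage_swap.frontier_near_vertical_edge hδ hy' h2 h1
  rw [← hf] at hA
  rw [← hi] at hB
  refine ⟨Prod.swap ⁻¹' U, continuous_swap.continuousAt.preimage_mem_nhds hU, fun z hz => ?_,
    fun z hz z' hz' e hzi => ?_⟩
  · simpa using hA z.swap hz
  · simpa using hB z.swap hz z'.swap hz' e (by simpa using hzi)

/-! ### Side directions of grid regions -/

theorem isSideDirection_vertical {T : Set (ℝ × ℝ)} {y : ℝ × ℝ} {U : Set (ℝ × ℝ)} (hU : U ∈ 𝓝 y)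
    (h : ∀ z ∈ U, z ∈ frontier T ↔ z.1 = y.1) : IsSideDirection T y (0, 1) := by
  refine ⟨by norm_num, U, hU, fun z hz => (h z hz).trans ⟨fun e => ⟨z.2 - y.2, ?_⟩, ?_⟩⟩
  · ext <;> simp [e]
  · rintro ⟨t, rfl⟩
    simp

theorem isSideDirection_horizontal {T : Set (ℝ × ℝ)} {y : ℝ × ℝ} {U : Set (ℝ × ℝ)} (hU : U ∈ 𝓝 y)
    (h : ∀ z ∈ U, z ∈ frontier T ↔ z.2 = y.2) : IsSideDirection T y (1, 0) := by
  refine ⟨by norm_num, U, hU, fun z hz => (h z hz).trans ⟨fun e => ⟨z.1 - y.1, ?_⟩, ?_⟩⟩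
  · ext <;> simp [e]
  · rintro ⟨t, rfl⟩
    simp

theorem IsGridRegion.not_isTableCorner {δ : ℝ} (hδ : 0 < δ) {T : Set (ℝ × ℝ)}
    (h : IsGridRegion δ T) {y : ℝ × ℝ}
    (hy : ¬ (y.1 ∈ AddSubgroup.zmultiples δ ∧ y.2 ∈ AddSubgroup.zmultiples δ)) :
    ¬ IsTableCorner T y := by
  rintro ⟨hf, hc⟩
  rcases h.mem_zmultiples_of_mem_frontier hδ hf with h1 | h2
  · obtain ⟨U, hU, hA, -⟩ := h.frontier_near_vertical_edge hδ hf h1 fun h2 => hy ⟨h1, h2⟩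
    exact hc _ (isSideDirection_vertical hU hA)
  · obtain ⟨U, hU, hA, -⟩ := h.frontier_near_horizontal_edge hδ hf (fun h1 => hy ⟨h1, h2⟩) h2
    exact hc _ (isSideDirection_horizontal hU hA)

/-! ### The billiard map -/

theorem continuous_ray (x u : ℝ × ℝ) : Continuous fun s : ℝ => x + s • u := by fun_prop

/-- In a compact table, every initial condition has a first collision. -/
theorem IsInitialCondition.exists_firstCollision {T : Set (ℝ × ℝ)} (hT : IsCompact T)
    {p : (ℝ × ℝ) × (ℝ × ℝ)} (hp : IsInitialCondition T p) : ∃ y, FirstCollision T p y := by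
  obtain ⟨-, hn, ε, hε, hin⟩ := hp
  set f : ℝ → ℝ × ℝ := fun s => p.1 + s • p.2 with hf
  have hfc : Continuous f := continuous_ray _ _
  have hu : 0 < ‖p.2‖ := by
    rw [norm_pos_iff]
    intro h
    rw [h] at hn
    norm_num at hn
  -- The collision time is the infimum of `A`. Times below `ε / 2` are cut off because the ray
  -- starts on the boundary; `A` is nonempty because the ray leaves the bounded table.
  set A : Set ℝ := Ici (ε / 2) ∩ f ⁻¹' (interior T)ᶜ with hA
  have hAc : IsClosed A := isClosed_Ici.inter (isOpen_interior.isClosed_compl.preimage hfc)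
  have hAn : A.Nonempty := by
    obtain ⟨R, hR⟩ := hT.isBounded.exists_norm_le
    have hs : 0 ≤ (|R| + ‖p.1‖ + 1) / ‖p.2‖ := by positivity
    refine ⟨ε / 2 + (|R| + ‖p.1‖ + 1) / ‖p.2‖, le_add_of_nonneg_right hs, fun hmem => ?_⟩
    have h1 := hR _ (interior_subset hmem)
    set s := ε / 2 + (|R| + ‖p.1‖ + 1) / ‖p.2‖ with hsdef
    have h2 : ‖s • p.2‖ ≤ ‖f s‖ + ‖p.1‖ := by
      have : s • p.2 = f s - p.1 := by simp [hf]
      rw [this]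
      exact norm_sub_le _ _
    rw [norm_smul, Real.norm_of_nonneg (by positivity)] at h2
    have h3 : s * ‖p.2‖ = ε / 2 * ‖p.2‖ + (|R| + ‖p.1‖ + 1) := by
      rw [hsdef, add_mul, div_mul_cancel₀ _ hu.ne']
    have h4 : 0 < ε / 2 * ‖p.2‖ := by positivity
    linarith [le_abs_self R]
  have hAb : BddBelow A := ⟨ε / 2, fun s hs => hs.1⟩
  have hmem : sInf A ∈ A := hAc.csInf_mem hAn hAb
  have hpos : 0 < sInf A := (half_pos hε).trans_le hmem.1
  have hbefore : ∀ r ∈ Ioo (0 : ℝ) (sInf A), f r ∈ interior T := by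
    intro r hr
    by_cases h : r < ε / 2
    · exact hin r ⟨hr.1, h.trans (half_lt_self hε)⟩
    · by_contra hc
      exact absurd (csInf_le hAb ⟨not_lt.1 h, hc⟩) (not_le.2 hr.2)
  refine ⟨f (sInf A), sInf A, hpos, hbefore, rfl, ?_, hmem.2⟩
  have hm : MapsTo f (Ioo 0 (sInf A)) T := fun r hr => interior_subset (hbefore r hr)
  refine hm.closure hfc ?_
  rw [closure_Ioo hpos.ne]
  exact right_mem_Icc.2 hpos.le

/-- If, near a boundary point `y`, membership in the interior is transported from the incoming ray to
the outgoing ray, then the outgoing ray starts in the interior. -/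
theorem FirstCollision.isInitialCondition {T : Set (ℝ × ℝ)} {p : (ℝ × ℝ) × (ℝ × ℝ)}
    {y v : ℝ × ℝ} (h : FirstCollision T p y) (hv : v.1 ^ 2 + v.2 ^ 2 = 1) {U : Set (ℝ × ℝ)}
    (hU : U ∈ 𝓝 y)
    (hT : ∀ r : ℝ, y + -r • p.2 ∈ U → y + r • v ∈ U → y + -r • p.2 ∈ interior T →
      y + r • v ∈ interior T) : IsInitialCondition T (y, v) := by
  obtain ⟨s, hs, hin, hys, hyf⟩ := h
  refine ⟨hyf, hv, ?_⟩
  have c1 : Continuous fun r : ℝ => y + -r • p.2 := by fun_prop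
  have e1 : ∀ᶠ r : ℝ in 𝓝 0, y + -r • p.2 ∈ U := c1.continuousAt (by simpa using hU)
  have e2 : ∀ᶠ r : ℝ in 𝓝 0, y + r • v ∈ U :=
    (continuous_ray y v).continuousAt (by simpa using hU)
  obtain ⟨ε, hε, hball⟩ := Metric.eventually_nhds_iff.1 (e1.and e2)
  refine ⟨min ε s, lt_min hε hs, fun r hr => ?_⟩
  have hr' := hball (y := r) (by
    rw [Real.dist_eq, sub_zero, abs_of_pos hr.1]; exact hr.2.trans_le (min_le_left _ _))
  refine hT r hr'.1 hr'.2 ?_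
  have : y + -r • p.2 = p.1 + (s - r) • p.2 := by rw [hys]; module
  rw [this]
  exact hin _ ⟨by linarith [hr.2.trans_le (min_le_right ε s)], by linarith [hr.1]⟩

/-- Two boundary points with the same direction and the same first collision point agree. -/
theorem FirstCollision.basepoint_unique {T : Set (ℝ × ℝ)} {x x' u y : ℝ × ℝ}
    (h : FirstCollision T (x, u) y) (h' : FirstCollision T (x', u) y) (hx : x ∈ frontier T)
    (hx' : x' ∈ frontier T) : x = x' := by
  obtain ⟨s, hs, hin, hys, -⟩ := h
  obtain ⟨s', hs', hin', hys', -⟩ := h'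
  simp only at hin hin' hys hys'
  -- If the flight times differ, the basepoint nearer to `y` lies strictly inside the other flight,
  -- hence in the interior.
  rcases lt_trichotomy s s' with hlt | rfl | hlt
  · refine absurd (hin' (s' - s) ⟨by linarith, by linarith⟩) ?_
    have : x' + (s' - s) • u = x := by
      rw [sub_smul, ← add_sub_assoc, ← hys', hys, add_sub_cancel_right]
    rw [this]
    exact hx.2
  · exact add_right_cancel (hys.symm.trans hys')
  · refine absurd (hin (s - s') ⟨by linarith, by linarith⟩) ?_
    have : x + (s - s') • u = x' := by
      rw [sub_smul, ← add_sub_assoc, ← hys, hys', add_sub_cancel_right]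
    rw [this]
    exact hx'.2

/-! ### Unfolding along a line -/

/-- One coordinate of a phase point, with position `x` and velocity `u`, is the image of the position
`a + s w` and velocity `w` under an isometry of the line generated by reflections in grid points. -/
def FoldsCoord (δ a w s x u : ℝ) : Prop :=
  (u = w ∧ x - (a + s * w) ∈ AddSubgroup.zmultiples δ) ∨
    (u = -w ∧ x + (a + s * w) ∈ AddSubgroup.zmultiples δ)

namespace FoldsCoord

variable {δ a w s x u : ℝ}

theorem advance (h : FoldsCoord δ a w s x u) (r : ℝ) : FoldsCoord δ a w (s + r) (x + r * u) u := by
  rcases h with ⟨rfl, h⟩ | ⟨rfl, h⟩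
  · exact Or.inl ⟨rfl, by convert h using 1; ring⟩
  · exact Or.inr ⟨rfl, by convert h using 1; ring⟩

/-- Since `2x` is a multiple of `δ`, reversing the velocity at `x` exchanges the two alternatives.
-/
theorem reflect (h : FoldsCoord δ a w s x u) (hx : x ∈ AddSubgroup.zmultiples δ) :
    FoldsCoord δ a w s x (-u) := by
  rcases h with ⟨rfl, h⟩ | ⟨rfl, h⟩
  · exact Or.inr ⟨rfl, by convert sub_mem (add_mem hx hx) h using 1; ring⟩
  · exact Or.inl ⟨neg_neg w, by convert sub_mem (add_mem hx hx) h using 1; ring⟩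

/-- Applied with `G` the grid itself, to detect corners, and with `G` a finer grid, to count states.
-/
theorem mem_iff {G : AddSubgroup ℝ} (hG : AddSubgroup.zmultiples δ ≤ G)
    (h : FoldsCoord δ a w s x u) : x ∈ G ↔ a + s * w ∈ G := by
  rcases h with ⟨rfl, h⟩ | ⟨rfl, h⟩
  · exact ⟨fun hx => by simpa using sub_mem hx (hG h), fun hx => by simpa using add_mem (hG h) hx⟩
  · exact ⟨fun hx => by simpa using sub_mem (hG h) hx, fun hx => by simpa using sub_mem (hG h) hx⟩

end FoldsCoord

/-- An initial condition that unfolds to a point of the line through `a` in direction `w`. -/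
structure IsFoldedState (T : Set (ℝ × ℝ)) (δ : ℝ) (a w : ℝ × ℝ) (p : (ℝ × ℝ) × (ℝ × ℝ)) : Prop where
  initial : IsInitialCondition T p
  folds : ∃ s, FoldsCoord δ a.1 w.1 s p.1.1 p.2.1 ∧ FoldsCoord δ a.2 w.2 s p.1.2 p.2.2

/-- The direction of `q` is obtained from that of `p` by reflection in a grid line through the
basepoint of `q`. -/
def GridReflected (δ : ℝ) (p q : (ℝ × ℝ) × (ℝ × ℝ)) : Prop :=
  (q.1.1 ∈ AddSubgroup.zmultiples δ ∧ q.2 = (-p.2.1, p.2.2)) ∨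
    (q.1.2 ∈ AddSubgroup.zmultiples δ ∧ q.2 = (p.2.1, -p.2.2))

section Dynamics

variable {T : Set (ℝ × ℝ)} {δ : ℝ} {a w : ℝ × ℝ} {p q : (ℝ × ℝ) × (ℝ × ℝ)}

theorem IsFoldedState.not_both_mem
    (hline : ∀ s : ℝ, ¬ (a.1 + s * w.1 ∈ AddSubgroup.zmultiples δ ∧
      a.2 + s * w.2 ∈ AddSubgroup.zmultiples δ))
    (hp : IsFoldedState T δ a w p) :
    ¬ (p.1.1 ∈ AddSubgroup.zmultiples δ ∧ p.1.2 ∈ AddSubgroup.zmultiples δ) := by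
  obtain ⟨s, h1, h2⟩ := hp.folds
  rw [h1.mem_iff le_rfl, h2.mem_iff le_rfl]
  exact hline s

/-- By `hline` the collision point lies on only one family of grid lines, so it is inside a side.
Near it the interior is invariant under shifts along that side, so the reflected ray starts in the
interior. -/
theorem IsFoldedState.exists_step (hδ : 0 < δ) (hT : IsGridRegion δ T) (hc : IsCompact T)
    (hline : ∀ s : ℝ, ¬ (a.1 + s * w.1 ∈ AddSubgroup.zmultiples δ ∧
      a.2 + s * w.2 ∈ AddSubgroup.zmultiples δ))
    (hp : IsFoldedState T δ a w p) :
    ∃ q, IsFoldedState T δ a w q ∧ BilliardStep T p q ∧ GridReflected δ p q := by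
  obtain ⟨y, hy⟩ := hp.initial.exists_firstCollision hc
  obtain ⟨r, -, -, hyr, hyf⟩ := id hy
  have hn := hp.initial.2.1
  obtain ⟨s, f1, f2⟩ := hp.folds
  replace f1 := f1.advance r
  replace f2 := f2.advance r
  have e1 : p.1.1 + r * p.2.1 = y.1 := by rw [hyr]; simp
  have e2 : p.1.2 + r * p.2.2 = y.2 := by rw [hyr]; simp
  rw [e1] at f1
  rw [e2] at f2
  have hnot : ¬ (y.1 ∈ AddSubgroup.zmultiples δ ∧ y.2 ∈ AddSubgroup.zmultiples δ) := by
    rw [f1.mem_iff le_rfl, f2.mem_iff le_rfl]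
    exact hline _
  rcases hT.mem_zmultiples_of_mem_frontier hδ hyf with h1 | h2
  · obtain ⟨U, hU, hA, hB⟩ := hT.frontier_near_vertical_edge hδ hyf h1 fun h2 => hnot ⟨h1, h2⟩
    refine ⟨(y, (-p.2.1, p.2.2)), ⟨?_, s + r, f1.reflect h1, f2⟩,
      ⟨hy, (0, 1), isSideDirection_vertical hU hA, ?_⟩, Or.inl ⟨h1, rfl⟩⟩
    -- The points at equal distance `ρ` before and after the collision differ by a shift along the
    -- side.
    · exact hy.isInitialCondition (by simpa using hn) hU fun ρ ha hb hi =>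
        hB _ ha _ hb (by simp) hi
    · ext <;> simp [reflectDirection]; ring
  · obtain ⟨U, hU, hA, hB⟩ := hT.frontier_near_horizontal_edge hδ hyf (fun h1 => hnot ⟨h1, h2⟩) h2
    refine ⟨(y, (p.2.1, -p.2.2)), ⟨?_, s + r, f1, f2.reflect h2⟩,
      ⟨hy, (1, 0), isSideDirection_horizontal hU hA, ?_⟩, Or.inr ⟨h2, rfl⟩⟩
    · exact hy.isInitialCondition (by simpa using hn) hU fun ρ ha hb hi =>
        hB _ ha _ hb (by simp) hi
    · ext <;> simp [reflectDirection]; ring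

/-- The basepoint of `q` lies on at most one family of grid lines, which determines the reflection.
Undoing it recovers the incoming direction, and tracing back to the boundary recovers the basepoint.
-/
theorem eq_of_common_step {p' : (ℝ × ℝ) × (ℝ × ℝ)}
    (hq : ¬ (q.1.1 ∈ AddSubgroup.zmultiples δ ∧ q.1.2 ∈ AddSubgroup.zmultiples δ))
    (hp : IsInitialCondition T p) (hp' : IsInitialCondition T p')
    (h : BilliardStep T p q) (h' : BilliardStep T p' q)
    (hr : GridReflected δ p q) (hr' : GridReflected δ p' q) : p = p' := by
  have hu : p.2 = p'.2 := by
    rcases hr with ⟨m, e⟩ | ⟨m, e⟩ <;> rcases hr' with ⟨m', e'⟩ | ⟨m', e'⟩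
    · have := e.symm.trans e'
      simp only [Prod.mk.injEq, neg_inj] at this
      exact Prod.ext this.1 this.2
    · exact absurd ⟨m, m'⟩ hq
    · exact absurd ⟨m', m⟩ hq
    · have := e.symm.trans e'
      simp only [Prod.mk.injEq, neg_inj] at this
      exact Prod.ext this.1 this.2
  obtain ⟨x, u⟩ := p
  obtain ⟨x', u'⟩ := p'
  simp only at hu
  subst hu
  rw [h.1.basepoint_unique h'.1 hp.1 hp'.1]

theorem finite_zmultiples_inter_Icc {η : ℝ} (hη : 0 < η) (R : ℝ) :
    {v : ℝ | v ∈ AddSubgroup.zmultiples η ∧ |v| ≤ R}.Finite := by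
  refine ((finite_Icc (-⌈R / η⌉) ⌈R / η⌉).image fun i : ℤ => (i : ℝ) * η).subset ?_
  rintro v ⟨hv, hR⟩
  obtain ⟨i, rfl⟩ := AddSubgroup.mem_zmultiples_iff.1 hv
  refine ⟨i, ?_, (zsmul_eq_mul _ _).symm⟩
  rw [zsmul_eq_mul, abs_mul, abs_of_pos hη, ← le_div_iff₀ hη] at hR
  have := hR.trans (Int.le_ceil _)
  rw [mem_Icc, ← abs_le]
  exact_mod_cast this

/-- A basepoint lies on a grid line, so it unfolds to a crossing and lies in the finer grid, within
a bounded set. Only the four directions `(±w.1, ±w.2)` occur. -/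
theorem finite_isFoldedState (hδ : 0 < δ) (hT : IsGridRegion δ T) (hc : IsCompact T) {η : ℝ}
    (hη : 0 < η) (hle : AddSubgroup.zmultiples δ ≤ AddSubgroup.zmultiples η)
    (hrat : ∀ s : ℝ, a.1 + s * w.1 ∈ AddSubgroup.zmultiples δ ∨
        a.2 + s * w.2 ∈ AddSubgroup.zmultiples δ →
      a.1 + s * w.1 ∈ AddSubgroup.zmultiples η ∧ a.2 + s * w.2 ∈ AddSubgroup.zmultiples η) :
    {p | IsFoldedState T δ a w p}.Finite := by
  obtain ⟨R, hR⟩ := hc.isBounded.exists_norm_le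
  have hF := finite_zmultiples_inter_Icc hη R
  refine ((hF.prod hF).prod
    ((toFinite {w.1, -w.1}).prod (toFinite {w.2, -w.2}))).subset fun p hp => ?_
  have hpf := hp.initial.1
  obtain ⟨s, h1, h2⟩ := hp.folds
  have hmem := hT.mem_zmultiples_of_mem_frontier hδ hpf
  rw [h1.mem_iff le_rfl, h2.mem_iff le_rfl] at hmem
  have hη' := hrat s hmem
  rw [← h1.mem_iff hle, ← h2.mem_iff hle] at hη'
  have hn := hR _ (hc.isClosed.frontier_subset hpf)
  refine ⟨⟨⟨hη'.1, (norm_fst_le p.1).trans hn⟩, hη'.2, (norm_snd_le p.1).trans hn⟩, ?_, ?_⟩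
  · rcases h1 with h | h <;> simp [h.1]
  · rcases h2 with h | h <;> simp [h.1]

/-- If the unfolded line avoids all grid points, the orbit is nonsingular. -/
theorem IsFoldedState.hasNonsingularOrbit (hδ : 0 < δ) (hT : IsGridRegion δ T) (hc : IsCompact T)
    (hline : ∀ s : ℝ, ¬ (a.1 + s * w.1 ∈ AddSubgroup.zmultiples δ ∧
      a.2 + s * w.2 ∈ AddSubgroup.zmultiples δ))
    (hp : IsFoldedState T δ a w p) : HasNonsingularOrbit T p := by
  choose f hf hstep _ using fun p : {p // IsFoldedState T δ a w p} =>
    p.2.exists_step hδ hT hc hline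
  set F : {p // IsFoldedState T δ a w p} → {p // IsFoldedState T δ a w p} := fun p => ⟨f p, hf p⟩
  refine ⟨fun k => (F^[k] ⟨p, hp⟩).1, ⟨rfl, fun k => ?_⟩, fun k => ?_⟩
  · simp only [Function.iterate_succ_apply']
    exact hstep _
  · exact hT.not_isTableCorner hδ ((F^[k] ⟨p, hp⟩).2.not_both_mem hline)

/-- If the unfolded line avoids all grid points and crosses the grid in points of a finer grid, the
orbit is periodic. -/
theorem IsFoldedState.hasPeriodicOrbit (hδ : 0 < δ) (hT : IsGridRegion δ T) (hc : IsCompact T)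
    (hline : ∀ s : ℝ, ¬ (a.1 + s * w.1 ∈ AddSubgroup.zmultiples δ ∧
      a.2 + s * w.2 ∈ AddSubgroup.zmultiples δ))
    {η : ℝ} (hη : 0 < η) (hle : AddSubgroup.zmultiples δ ≤ AddSubgroup.zmultiples η)
    (hrat : ∀ s : ℝ, a.1 + s * w.1 ∈ AddSubgroup.zmultiples δ ∨
        a.2 + s * w.2 ∈ AddSubgroup.zmultiples δ →
      a.1 + s * w.1 ∈ AddSubgroup.zmultiples η ∧ a.2 + s * w.2 ∈ AddSubgroup.zmultiples η)
    (hp : IsFoldedState T δ a w p) : HasPeriodicOrbit T p := by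
  choose f hf hstep hrefl using fun p : {p // IsFoldedState T δ a w p} =>
    p.2.exists_step hδ hT hc hline
  set F : {p // IsFoldedState T δ a w p} → {p // IsFoldedState T δ a w p} := fun p => ⟨f p, hf p⟩
  have hinj : Function.Injective F := by
    intro p p' h
    have h : f p = f p' := congrArg Subtype.val h
    refine Subtype.ext (eq_of_common_step ((hf p).not_both_mem hline) p.2.initial p'.2.initial
      (hstep p) ?_ (hrefl p) ?_)
    · rw [h]; exact hstep p'
    · rw [h]; exact hrefl p'
  have : Finite {p // IsFoldedState T δ a w p} :=
    (finite_isFoldedState hδ hT hc hη hle hrat).to_subtype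
  -- An injective self-map of a finite set is a permutation, so the orbit is periodic from its
  -- start, not just eventually.
  obtain ⟨N, hN, hper⟩ := hinj.mem_periodicPts ⟨p, hp⟩
  refine ⟨fun k => (F^[k] ⟨p, hp⟩).1, ⟨rfl, fun k => ?_⟩, N, hN, fun k => ?_⟩
  · simp only [Function.iterate_succ_apply']
    exact hstep _
  · simp only [Function.iterate_add_apply, hper.eq]

end Dynamics

/-! ### The prefractal tables are grid regions -/

/-- One may take `S` to be all cells contained in `T`; this local form makes unions and subdivisions
easy. -/
theorem isGridRegion_iff_forall {δ : ℝ} {T : Set (ℝ × ℝ)} :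
    IsGridRegion δ T ↔ ∀ z ∈ T, ∃ c, z ∈ gridCell δ c ∧ gridCell δ c ⊆ T := by
  constructor
  · rintro ⟨S, rfl⟩ z hz
    simp only [mem_iUnion, exists_prop] at hz
    obtain ⟨c, hc, hz⟩ := hz
    exact ⟨c, hz, subset_biUnion_of_mem (u := gridCell δ) hc⟩
  · intro h
    refine ⟨{c | gridCell δ c ⊆ T}, subset_antisymm (fun z hz => ?_) (iUnion₂_subset fun c hc => hc)⟩
    obtain ⟨c, hz, hc⟩ := h z hz
    exact mem_biUnion hc hz

theorem IsGridRegion.union {δ : ℝ} {A B : Set (ℝ × ℝ)} (hA : IsGridRegion δ A)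
    (hB : IsGridRegion δ B) : IsGridRegion δ (A ∪ B) := by
  rw [isGridRegion_iff_forall] at *
  rintro z (hz | hz)
  · exact (hA z hz).imp fun c hc => ⟨hc.1, hc.2.trans subset_union_left⟩
  · exact (hB z hz).imp fun c hc => ⟨hc.1, hc.2.trans subset_union_right⟩

theorem exists_grid_interval_subset {δ v : ℝ} (hδ : 0 < δ) {a b : ℤ} (hab : a < b)
    (hv : v ∈ Icc (a * δ) (b * δ)) :
    ∃ i : ℤ, v ∈ Icc (i * δ) ((i + 1) * δ) ∧
      Icc (i * δ) ((i + 1) * δ) ⊆ Icc (a * δ) (b * δ) := by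
  suffices ∃ i : ℤ, a ≤ i ∧ i + 1 ≤ b ∧ v ∈ Icc (i * δ) ((i + 1) * δ) by
    obtain ⟨i, h1, h2, h3⟩ := this
    refine ⟨i, h3, Icc_subset_Icc ?_ ?_⟩
    · exact mul_le_mul_of_nonneg_right (by exact_mod_cast h1) hδ.le
    · exact mul_le_mul_of_nonneg_right (by exact_mod_cast h2) hδ.le
  have h1 : a ≤ ⌊v / δ⌋ := Int.le_floor.2 ((le_div_iff₀ hδ).2 hv.1)
  have h2 : ⌊v / δ⌋ * δ ≤ v := (le_div_iff₀ hδ).1 (Int.floor_le _)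
  have h3 : v < (⌊v / δ⌋ + 1) * δ := (div_lt_iff₀ hδ).1 (Int.lt_floor_add_one _)
  by_cases h : ⌊v / δ⌋ + 1 ≤ b
  · exact ⟨_, h1, h, h2, h3.le⟩
  -- Only the right end `v = b * δ` remains; its floor cell sticks out, so the last cell is used.
  · refine ⟨b - 1, by omega, by omega, ?_, ?_⟩
    · refine le_trans (mul_le_mul_of_nonneg_right ?_ hδ.le) h2
      exact_mod_cast (show b - 1 ≤ ⌊v / δ⌋ by omega)
    · simpa using hv.2

theorem isGridRegion_rectangle {δ : ℝ} (hδ : 0 < δ) {a b c d : ℤ} (hab : a < b) (hcd : c < d) :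
    IsGridRegion δ (Icc (a * δ) (b * δ) ×ˢ Icc (c * δ) (d * δ)) := by
  rw [isGridRegion_iff_forall]
  rintro z ⟨h1, h2⟩
  obtain ⟨i, hi, hi'⟩ := exists_grid_interval_subset hδ hab h1
  obtain ⟨j, hj, hj'⟩ := exists_grid_interval_subset hδ hcd h2
  exact ⟨(i, j), ⟨hi, hj⟩, prod_mono hi' hj'⟩

theorem IsGridRegion.half {δ : ℝ} (hδ : 0 < δ) {T : Set (ℝ × ℝ)} (h : IsGridRegion δ T) :
    IsGridRegion (δ / 2) T := by
  rw [isGridRegion_iff_forall] at *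
  intro z hz
  obtain ⟨c, hzc, hc⟩ := h z hz
  have e : gridCell δ c = Icc ((2 * c.1 : ℤ) * (δ / 2)) ((2 * c.1 + 2 : ℤ) * (δ / 2)) ×ˢ
      Icc ((2 * c.2 : ℤ) * (δ / 2)) ((2 * c.2 + 2 : ℤ) * (δ / 2)) := by
    rw [gridCell]
    congr 2 <;> push_cast <;> ring
  have := isGridRegion_rectangle (half_pos hδ) (a := 2 * c.1) (b := 2 * c.1 + 2) (c := 2 * c.2)
    (d := 2 * c.2 + 2) (by omega) (by omega)
  rw [← e, isGridRegion_iff_forall] at this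
  exact (this z hzc).imp fun c' hc' => ⟨hc'.1, hc'.2.trans hc⟩

/-- The cell of index `c` goes to the cell of index `c + d` of the halved grid, provided the
translation is a vector of that grid. -/
theorem IsGridRegion.image_half_add {δ : ℝ} {T : Set (ℝ × ℝ)} (h : IsGridRegion δ T)
    {v : ℝ × ℝ} {d : ℤ × ℤ} (h1 : v.1 = d.1 * (δ / 2)) (h2 : v.2 = d.2 * (δ / 2)) :
    IsGridRegion (δ / 2) ((fun x : ℝ × ℝ => (1 / 2 : ℝ) • x + v) '' T) := by
  rw [isGridRegion_iff_forall] at *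
  rintro _ ⟨z, hz, rfl⟩
  obtain ⟨c, hzc, hc⟩ := h z hz
  refine ⟨c + d, ?_, fun y hy => ⟨(2 : ℝ) • (y - v), hc ?_, ?_⟩⟩
  · simp only [gridCell, mem_prod, mem_Icc, Prod.fst_add, Prod.snd_add, Prod.smul_fst,
      Prod.smul_snd, smul_eq_mul, h1, h2, Int.cast_add] at hzc ⊢
    refine ⟨⟨?_, ?_⟩, ?_, ?_⟩ <;> linarith [hzc.1.1, hzc.1.2, hzc.2.1, hzc.2.2]
  · simp only [gridCell, mem_prod, mem_Icc, Prod.fst_add, Prod.snd_add, Prod.smul_fst, Prod.fst_sub,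
      Prod.snd_sub, Prod.smul_snd, smul_eq_mul, h1, h2, Int.cast_add] at hy ⊢
    refine ⟨⟨?_, ?_⟩, ?_, ?_⟩ <;> linarith [hy.1.1, hy.1.2, hy.2.1, hy.2.2]
  · module

theorem isGridRegion_tTableZero : IsGridRegion (1 / 2) tTableZero := by
  have h1 := isGridRegion_rectangle (δ := 1 / 2) (by norm_num) (a := 0) (b := 2) (c := 0) (d := 2)
    (by norm_num) (by norm_num)
  have h2 := isGridRegion_rectangle (δ := 1 / 2) (by norm_num) (a := -1) (b := 3) (c := 2) (d := 3)
    (by norm_num) (by norm_num)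
  convert h1.union h2 using 1
  norm_num [tTableZero]

theorem IsGridRegion.tIFS {N : ℕ} {A : Set (ℝ × ℝ)} (h : IsGridRegion ((1 / 2) ^ (N + 1)) A) :
    IsGridRegion ((1 / 2) ^ (N + 2)) (tIFS A) := by
  have hN : ((1 / 2 : ℝ)) ^ (N + 2) = (1 / 2) ^ (N + 1) / 2 := by ring
  have hp : (2 : ℝ) ^ N * (1 / 2) ^ N = 1 := by rw [← mul_pow]; norm_num
  rw [hN]
  -- The translations `(1, 3/2)` and `(-1/2, 3/2)` written in units of `2^-(N+2)`.
  refine IsGridRegion.union (h.image_half_add (d := (2 ^ (N + 2), 3 * 2 ^ (N + 1))) ?_ ?_)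
    (h.image_half_add (d := (-2 ^ (N + 1), 3 * 2 ^ (N + 1))) ?_ ?_)
  · push_cast
    linear_combination (-1 : ℝ) * hp
  · push_cast
    linear_combination (-3 / 2 : ℝ) * hp
  · push_cast
    linear_combination (1 / 2 : ℝ) * hp
  · push_cast
    linear_combination (-3 / 2 : ℝ) * hp

theorem isGridRegion_iterate_tIFS (j : ℕ) :
    IsGridRegion ((1 / 2) ^ (j + 1)) (tIFS^[j] tTableZero) := by
  induction j with
  | zero => simpa using isGridRegion_tTableZero
  | succ j ih =>
    rw [Function.iterate_succ_apply']
    exact ih.tIFS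

theorem IsGridRegion.mono_pow {N M : ℕ} (h : N ≤ M) {A : Set (ℝ × ℝ)}
    (hA : IsGridRegion ((1 / 2) ^ N) A) : IsGridRegion ((1 / 2) ^ M) A := by
  induction M, h using Nat.le_induction with
  | base => exact hA
  | succ M _ ih =>
    rw [pow_succ, mul_one_div]
    exact ih.half (by positivity)

theorem isGridRegion_tTable (n : ℕ) : IsGridRegion ((1 / 2) ^ (n + 1)) (tTable n) := by
  rw [isGridRegion_iff_forall]
  intro z hz
  simp only [tTable, mem_iUnion, exists_prop] at hz
  obtain ⟨j, hj, hz⟩ := hz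
  have := (isGridRegion_iterate_tIFS j).mono_pow (Nat.succ_le_succ hj)
  rw [isGridRegion_iff_forall] at this
  exact (this z hz).imp fun c hc => ⟨hc.1, hc.2.trans
    (subset_biUnion_of_mem (u := fun j => tIFS^[j] tTableZero) (s := {j | j ≤ n}) hj)⟩

theorem isCompact_tTable (n : ℕ) : IsCompact (tTable n) := by
  refine (finite_le_nat n).isCompact_biUnion fun j hj => ?_
  clear hj
  induction j with
  | zero => exact (isCompact_Icc.prod isCompact_Icc).union (isCompact_Icc.prod isCompact_Icc)
  | succ j ih =>
    rw [Function.iterate_succ_apply']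
    refine (ih.image ?_).union (ih.image ?_)
    · unfold tMapRight
      fun_prop
    · unfold tMapLeft
      fun_prop

theorem tTableZero_subset_tTable (n : ℕ) : tTableZero ⊆ tTable n :=
  subset_biUnion_of_mem (u := fun j => tIFS^[j] tTableZero) (s := {j | j ≤ n}) (Nat.zero_le n)

/-- Keeps the open bottom side on the boundary of every table: no later copy is attached below it.
-/
theorem tTable_subset_upperHalfPlane (n : ℕ) : tTable n ⊆ {z | 0 ≤ z.2} := by
  refine iUnion₂_subset fun j hj => ?_
  clear hj
  induction j with
  | zero =>
    rintro z (hz | hz)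
    · exact hz.2.1
    · exact zero_le_one.trans hz.2.1
  | succ j ih =>
    rw [Function.iterate_succ_apply']
    rintro _ (⟨z, hz, rfl⟩ | ⟨z, hz, rfl⟩)
    all_goals
      have : 0 ≤ z.2 := ih hz
      simp only [tMapRight, tMapLeft, mem_ofPred_eq, Prod.snd_add, Prod.smul_snd, smul_eq_mul]
      linarith

theorem Ioo_prod_Ioo_subset_interior_tTable (n : ℕ) :
    Ioo (0 : ℝ) 1 ×ˢ Ioo (0 : ℝ) 1 ⊆ interior (tTable n) :=
  interior_maximal ((prod_mono Ioo_subset_Icc_self Ioo_subset_Icc_self).trans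
    (subset_union_left.trans (tTableZero_subset_tTable n))) (isOpen_Ioo.prod isOpen_Ioo)

theorem base_mem_frontier_tTable (n : ℕ) {x : ℝ} (hx : x ∈ Ioo (0 : ℝ) 1) :
    ((x, 0) : ℝ × ℝ) ∈ frontier (tTable n) := by
  refine ⟨subset_closure (tTableZero_subset_tTable n
    (Or.inl ⟨Ioo_subset_Icc_self hx, by simp⟩)), fun h => ?_⟩
  have h1 := interior_mono (tTable_subset_upperHalfPlane n) h
  have h2 : interior {z : ℝ × ℝ | 0 ≤ z.2} = {z | 0 < z.2} := by
    have := isOpenMap_snd.preimage_interior_eq_interior_preimage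
      (continuous_snd (X := ℝ) (Y := ℝ)) (Ici 0)
    rw [interior_Ici] at this
    exact this.symm
  rw [h2] at h1
  exact lt_irrefl (0 : ℝ) h1

theorem isInitialCondition_base (n : ℕ) {x : ℝ} (hx : x ∈ Ioo (0 : ℝ) 1) {u : ℝ × ℝ}
    (hu : u.1 ^ 2 + u.2 ^ 2 = 1) (hu2 : 0 < u.2) :
    IsInitialCondition (tTable n) ((x, 0), u) := by
  refine ⟨base_mem_frontier_tTable n hx, hu, ?_⟩
  have e1 : ∀ᶠ s : ℝ in 𝓝 0, x + s * u.1 ∈ Ioo (0 : ℝ) 1 := by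
    have : Continuous fun s : ℝ => x + s * u.1 := by fun_prop
    exact this.continuousAt (isOpen_Ioo.mem_nhds (by simpa using hx))
  have e2 : ∀ᶠ s : ℝ in 𝓝 0, s * u.2 < 1 := by
    have : Continuous fun s : ℝ => s * u.2 := by fun_prop
    exact this.continuousAt (isOpen_Iio.mem_nhds (by simp))
  obtain ⟨ε, hε, hball⟩ := Metric.eventually_nhds_iff.1 (e1.and e2)
  refine ⟨ε, hε, fun s hs => Ioo_prod_Ioo_subset_interior_tTable n ?_⟩
  have := hball (y := s) (by rw [Real.dist_eq, sub_zero, abs_of_pos hs.1]; exact hs.2)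
  refine ⟨by simpa using this.1, ?_, ?_⟩
  · simpa using mul_pos hs.1 hu2
  · simpa using this.2

/-! ### Compatible sequences starting on the bottom side -/

theorem isCompatibleSequence_const_base {x : ℝ} (hx : x ∈ Ioo (0 : ℝ) 1) {u : ℝ × ℝ}
    (hu : u.1 ^ 2 + u.2 ^ 2 = 1) (hu2 : 0 < u.2) :
    IsCompatibleSequence fun _ => ((x, 0), u) := by
  intro m n _
  have hn := isInitialCondition_base n hx hu hu2
  refine ⟨isInitialCondition_base m hx hu hu2, hn, rfl, ?_⟩
  obtain ⟨-, -, ε, hε, hin⟩ := id hn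
  refine ⟨0, ε / 2, half_pos hε, ⟨0, ⟨le_rfl, (half_pos hε).le⟩, by simp⟩, ?_⟩
  refine subset_antisymm ?_ ?_
  · rintro _ ⟨⟨s, hs, rfl⟩, hf⟩
    rcases hs.1.eq_or_lt with rfl | h0
    · simp
    · exact absurd (hin s ⟨h0, hs.2.trans_lt (half_lt_self hε)⟩) hf.2
  · rintro _ rfl
    exact ⟨⟨0, ⟨le_rfl, (half_pos hε).le⟩, by simp⟩, hn.1⟩

/-- The starting point lies on the compatibility segment and on the boundary of the `n`-th table,
where only the basepoint of `c n` is allowed. -/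
theorem IsCompatibleSequence.eq_base {c : ℕ → (ℝ × ℝ) × (ℝ × ℝ)} (hc : IsCompatibleSequence c)
    {x : ℝ} (hx : x ∈ Ioo (0 : ℝ) 1) {u : ℝ × ℝ} (h0 : c 0 = ((x, 0), u)) (n : ℕ) :
    c n = ((x, 0), u) := by
  rcases n.eq_zero_or_pos with rfl | hn
  · exact h0
  · obtain ⟨-, -, hdir, a, b, -, hmem, hsing⟩ := hc 0 n hn
    rw [h0] at hdir hmem
    have := hsing.subset ⟨hmem, base_mem_frontier_tTable n hx⟩
    exact Prod.ext (mem_singleton_iff.1 this).symm hdir.symm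

/-! ### Arithmetic of the slope -/

theorem mem_zmultiples_half_pow {N : ℕ} {v : ℝ} :
    v ∈ AddSubgroup.zmultiples ((1 / 2 : ℝ) ^ N) ↔ ∃ i : ℤ, v = i / 2 ^ N := by
  simp only [AddSubgroup.mem_zmultiples_iff, zsmul_eq_mul, one_div, inv_pow, ← div_eq_mul_inv,
    eq_comm]

/-- Both slope conditions prevent the line from meeting dyadic grid points. -/
theorem slope_avoids_grid {t h k : ℕ} (ht : 0 < t) (hk : 0 < k) (hh : Odd h)
    (hth : Nat.Coprime t h) (hlt : t < h ^ k) {m : ℝ}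
    (hslope :
      (∀ p q r s : ℤ, 0 ≤ r → 0 ≤ s →
        m ≠ ((q : ℝ) * (2 : ℝ) ^ (r - s) * (h : ℝ) ^ k) /
          ((p : ℝ) * (h : ℝ) ^ k - (t : ℝ) * (2 : ℝ) ^ r)) ∨
      (∃ α β γ : ℕ, m = (2 : ℝ) ^ γ / (2 * (α : ℝ) + 1) ^ β)) (N : ℕ) (p q : ℤ) :
    m * (p / 2 ^ N - t / (h : ℝ) ^ k) ≠ q / 2 ^ N := by
  have hh0 : (h : ℝ) ^ k ≠ 0 := pow_ne_zero _ (by exact_mod_cast hh.pos.ne')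
  have h2 : (2 : ℝ) ^ N ≠ 0 := by positivity
  have hh1 : h ≠ 1 := by
    rintro rfl
    -- With `h = 1` there is no room for `0 < t < 1`.
    rw [one_pow] at hlt
    omega
  have hnot : ∀ γ : ℕ, ¬ (h : ℤ) ∣ 2 ^ γ * t := by
    intro γ hdvd
    have hcop : IsCoprime (h : ℤ) (2 ^ γ * t) := by
      refine IsCoprime.mul_right (IsCoprime.pow_right ?_) ?_
      · exact_mod_cast Nat.isCoprime_iff_coprime.2 (Nat.coprime_two_right.2 hh)
      · exact Nat.isCoprime_iff_coprime.2 hth.symm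
    have := hcop.isUnit_of_dvd' dvd_rfl hdvd
    rw [Int.isUnit_iff] at this
    omega
  have hdk : (h : ℤ) ∣ (h : ℤ) ^ k := dvd_pow_self _ hk.ne'
  intro heq
  have heq' : m * (p * (h : ℝ) ^ k - t * 2 ^ N) = q * (h : ℝ) ^ k := by
    field_simp at heq
    linear_combination heq
  rcases hslope with hs | ⟨α, β, γ, rfl⟩
  · have hD : (p : ℝ) * (h : ℝ) ^ k - t * 2 ^ N ≠ 0 := by
      intro h0
      have h0' : p * (h : ℤ) ^ k = 2 ^ N * t := by
        have : (p : ℝ) * (h : ℝ) ^ k = 2 ^ N * t := by linarith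
        exact_mod_cast this
      exact hnot N (h0' ▸ hdk.mul_left p)
    -- The case `r = s = N` suffices. A zero denominator would give `h ∣ 2 ^ N * t`, so the
    -- forbidden value is a genuine quotient.
    refine hs p q N N (by positivity) (by positivity) ?_
    rw [sub_self, zpow_zero, mul_one, zpow_natCast, eq_div_iff hD, heq']
  · have hα : (2 * (α : ℝ) + 1) ^ β ≠ 0 := by positivity
    rw [div_mul_eq_mul_div, div_eq_iff hα] at heq'
    -- Reducing this integer identity modulo `h` gives `h ∣ 2 ^ (γ + N) * t`.
    have hz : (2 : ℤ) ^ γ * (p * (h : ℤ) ^ k - t * 2 ^ N) =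
        q * (h : ℤ) ^ k * (2 * α + 1) ^ β := by exact_mod_cast heq'
    apply hnot (γ + N)
    have : (2 : ℤ) ^ (γ + N) * t = (2 ^ γ * p - q * (2 * α + 1) ^ β) * (h : ℤ) ^ k := by
      rw [pow_add]
      linear_combination -hz
    rw [this]
    exact hdk.mul_left _

/-- A line of nonzero rational slope through a rational point crosses the lines of a dyadic grid in
points of a finer grid. -/
theorem exists_finer_grid {a b : ℕ} (hb : 0 < b) {ρ : ℚ} (hρ : ρ ≠ 0) {w : ℝ × ℝ}
    (hw : w.2 = ρ * w.1) (N : ℕ) :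
    ∃ η > 0, AddSubgroup.zmultiples ((1 / 2 : ℝ) ^ N) ≤ AddSubgroup.zmultiples η ∧
      ∀ s : ℝ, (a / b : ℝ) + s * w.1 ∈ AddSubgroup.zmultiples ((1 / 2 : ℝ) ^ N) ∨
          0 + s * w.2 ∈ AddSubgroup.zmultiples ((1 / 2 : ℝ) ^ N) →
        (a / b : ℝ) + s * w.1 ∈ AddSubgroup.zmultiples η ∧
          0 + s * w.2 ∈ AddSubgroup.zmultiples η := by
  have hc0 : (ρ.num : ℝ) ≠ 0 := by exact_mod_cast Rat.num_ne_zero.2 hρ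
  have hd0 : (ρ.den : ℝ) ≠ 0 := by exact_mod_cast ρ.den_ne_zero
  have hb0 : (b : ℝ) ≠ 0 := by exact_mod_cast hb.ne'
  have hρe : (ρ : ℝ) = ρ.num / ρ.den := Rat.cast_def ρ
  set c : ℤ := ρ.num
  set d : ℕ := ρ.den
  -- Vertical crossings have height `(c / d) * (i / 2 ^ N - a / b)`, horizontal ones abscissa `i * d
  -- / (2 ^ N * c)`; this number clears all denominators. The numerator `c` may be negative, so its
  -- square keeps the mesh positive.
  have hM : (0 : ℝ) < 2 ^ N * b * d * (c : ℝ) ^ 2 := by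
    have : (0 : ℝ) < b := by exact_mod_cast hb
    have : (0 : ℝ) < d := by exact_mod_cast ρ.den_pos
    positivity
  have key : ∀ (v : ℝ) (i : ℤ), v * (2 ^ N * b * d * (c : ℝ) ^ 2) = i →
      v ∈ AddSubgroup.zmultiples (1 / (2 ^ N * b * d * (c : ℝ) ^ 2)) := by
    intro v i hv
    rw [AddSubgroup.mem_zmultiples_iff]
    exact ⟨i, by rw [zsmul_eq_mul, ← hv, mul_one_div, mul_div_cancel_right₀ _ hM.ne']⟩
  have hle : AddSubgroup.zmultiples ((1 / 2 : ℝ) ^ N) ≤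
      AddSubgroup.zmultiples (1 / (2 ^ N * b * d * (c : ℝ) ^ 2)) := by
    intro v hv
    obtain ⟨i, rfl⟩ := mem_zmultiples_half_pow.1 hv
    refine key _ (i * b * d * c ^ 2) ?_
    push_cast
    field_simp
  refine ⟨_, one_div_pos.2 hM, hle, fun s hs => ?_⟩
  rcases hs with hs | hs
  · refine ⟨hle hs, ?_⟩
    obtain ⟨i, hi⟩ := mem_zmultiples_half_pow.1 hs
    refine key _ (c * (i * b - a * 2 ^ N) * c ^ 2) ?_
    have : s * w.1 = i / 2 ^ N - a / b := by linarith
    rw [zero_add, hw, mul_left_comm s, this, hρe]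
    push_cast
    field_simp
  · refine ⟨?_, hle hs⟩
    obtain ⟨i, hi⟩ := mem_zmultiples_half_pow.1 hs
    refine key _ (a * 2 ^ N * d * c ^ 2 + i * d * b * d * c) ?_
    have : s * w.1 = i / 2 ^ N * d / c := by
      rw [← hi, hw, hρe]
      field_simp
      ring
    rw [this]
    push_cast
    field_simp

theorem mainTheorem3 (t h k : ℕ) (ht : 0 < t) (hk : 0 < k) (hh : Odd h) (hth : Nat.Coprime t h)
    (hlt : t < h ^ k) (x₀ : ℝ) (hx₀ : x₀ = (t : ℝ) / (h : ℝ) ^ k)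
    (θ : ℝ) (hθ : θ ∈ Set.Ioo 0 Real.pi) (hθ' : θ ≠ Real.pi / 2)
    (m : ℝ) (hm : m = Real.tan θ)
    (hslope :
      (∀ p q r s : ℤ, 0 ≤ r → 0 ≤ s →
        m ≠ ((q : ℝ) * (2 : ℝ) ^ (r - s) * (h : ℝ) ^ k) /
          ((p : ℝ) * (h : ℝ) ^ k - (t : ℝ) * (2 : ℝ) ^ r)) ∨
      (∃ α β γ : ℕ, m = (2 : ℝ) ^ γ / (2 * (α : ℝ) + 1) ^ β)) :
    (∃ c : ℕ → (ℝ × ℝ) × (ℝ × ℝ), IsCompatibleSequence c ∧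
      c 0 = ((x₀, 0), (Real.cos θ, Real.sin θ))) ∧
    ∀ c : ℕ → (ℝ × ℝ) × (ℝ × ℝ), IsCompatibleSequence c →
      c 0 = ((x₀, 0), (Real.cos θ, Real.sin θ)) →
      (∀ n, HasNonsingularOrbit (tTable n) (c n)) ∧
      ((∃ ρ : ℚ, (ρ : ℝ) = m) → ∀ n, HasPeriodicOrbit (tTable n) (c n)) := by
  have hsin : 0 < Real.sin θ := Real.sin_pos_of_mem_Ioo hθ
  have hcos : Real.cos θ ≠ 0 := by
    intro h0
    rcases lt_or_gt_of_ne hθ' with hlt | hgt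
    · exact (Real.cos_pos_of_mem_Ioo ⟨by linarith [hθ.1, Real.pi_pos], hlt⟩).ne' h0
    · exact (Real.cos_neg_of_pi_div_two_lt_of_lt hgt (by linarith [hθ.2, Real.pi_pos])).ne h0
  have hsc : Real.sin θ = m * Real.cos θ := by rw [hm, Real.tan_mul_cos hcos]
  have hhk : (0 : ℝ) < (h : ℝ) ^ k := pow_pos (by exact_mod_cast hh.pos) _
  have hx : x₀ ∈ Ioo (0 : ℝ) 1 := by
    rw [hx₀]
    exact ⟨div_pos (by exact_mod_cast ht) hhk, (div_lt_one hhk).2 (by exact_mod_cast hlt)⟩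
  have hunit : Real.cos θ ^ 2 + Real.sin θ ^ 2 = 1 := Real.cos_sq_add_sin_sq θ
  refine ⟨⟨_, isCompatibleSequence_const_base (u := (Real.cos θ, Real.sin θ)) hx hunit hsin, rfl⟩,
    fun c hc h0 => ?_⟩
  have hline : ∀ (N : ℕ) (s : ℝ),
      ¬ (x₀ + s * Real.cos θ ∈ AddSubgroup.zmultiples ((1 / 2 : ℝ) ^ N) ∧
        0 + s * Real.sin θ ∈ AddSubgroup.zmultiples ((1 / 2 : ℝ) ^ N)) := by
    rintro N s ⟨h1, h2⟩
    obtain ⟨p, hp⟩ := mem_zmultiples_half_pow.1 h1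
    obtain ⟨q, hq⟩ := mem_zmultiples_half_pow.1 h2
    refine slope_avoids_grid ht hk hh hth hlt hslope N p q ?_
    rw [← hx₀, ← hp, ← hq, hsc]
    ring
  have hstate : ∀ n, IsFoldedState (tTable n) ((1 / 2) ^ (n + 1)) (x₀, 0)
      (Real.cos θ, Real.sin θ) (c n) := by
    intro n
    rw [hc.eq_base hx h0 n]
    exact ⟨isInitialCondition_base n hx hunit hsin, 0, Or.inl ⟨rfl, by simp⟩, Or.inl ⟨rfl, by simp⟩⟩
  refine ⟨fun n => (hstate n).hasNonsingularOrbit (by positivity) (isGridRegion_tTable n)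
    (isCompact_tTable n) (hline _), ?_⟩
  rintro ⟨ρ, hρ⟩ n
  have hρ0 : ρ ≠ 0 := by
    rintro rfl
    rw [← hρ, Rat.cast_zero, zero_mul] at hsc
    exact hsin.ne' hsc
  obtain ⟨η, hη, hle, hrat⟩ := exists_finer_grid (a := t) (b := h ^ k) (pow_pos hh.pos k) hρ0
    (w := (Real.cos θ, Real.sin θ)) (by rw [hρ]; exact hsc) (n + 1)
  rw [Nat.cast_pow, ← hx₀] at hrat
  exact (hstate n).hasPeriodicOrbit (by positivity) (isGridRegion_tTable n)
    (isCompact_tTable n) (hline _) hη hle hrat
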